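/- Let $p$ be a prime, $G$ a finite group and $(K,\mathcal{O},F)$ a splitting $p$-modular system for $G$: $\mathcal{O}$ is a complete discrete valuation ring with quotient field $K$ of characteristic $0$ and residue field $F$ of characteristic $p$, and both $K$ and $F$ are splitting fields for $G$. Let $B$ be a block of the group algebra $FG$, let $k(B)$ and $l(B)$ be the numbers of irreducible ordinary characters and of irreducible Brauer characters associated to $B$, respectively, and let $LL(\mathbf{Z}B)$ be the Loewy length of the center $\mathbf{Z}B$ of $B$, that is, the least integer $n\ge 0$ with $\mathbf{J}(\mathbf{Z}B)^n=0$, where $\mathbf{J}$ denotes the Jacobson radical. Then \[ LL(\mathbf{Z}B)\le k(B)-l(B)+1. \] -/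

import Mathlib

noncomputable section

open Polynomial IsLocalRing

namespace BlockTheory

/-- The Loewy length of a (finite-dimensional) algebra `A`: the least `n` with `J(A) ^ n = 0`,
where `J(A)` is the Jacobson radical of `A`. -/
def loewyLength (A : Type*) [CommRing A] : ℕ :=
  sInf {n : ℕ | Ring.jacobson A ^ n = ⊥}

/-- `k` is a splitting field for the group `G`: every irreducible (finite-dimensional)
representation of `G` over `k` has only scalar endomorphisms. -/
def IsSplittingFieldFor (k G : Type*) [Field k] [Group G] : Prop :=
  ∀ (n : ℕ) (ρ : Representation k G (Fin n → k)), ρ.IsIrreducible →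
    ∀ f : Module.End k (Fin n → k), (∀ g : G, Commute f (ρ g)) → ∃ c : k, f = c • 1

/-- `e` is a block idempotent of the group algebra `FG`, i.e. a primitive idempotent of the
center of `FG`. The block belonging to it is the algebra `B = FG e = e FG e`. -/
structure IsBlockIdempotent {F G : Type*} [Field F] [Group G] (e : MonoidAlgebra F G) :
    Prop where
  mem_center : e ∈ Subring.center (MonoidAlgebra F G)
  idem : IsIdempotentElem e
  ne_zero : e ≠ 0
  primitive : ∀ f ∈ Subring.center (MonoidAlgebra F G),
    IsIdempotentElem f → f * e = f → f = 0 ∨ f = e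

/-- The block algebra `B = e FG e` (`= FG e`, as `e` is central), a ring with identity `e`. -/
abbrev IsBlockIdempotent.BlockAlgebra {F G : Type*} [Field F] [Group G] {e : MonoidAlgebra F G}
    (he : IsBlockIdempotent e) : Type _ :=
  he.idem.Corner

/-- The center `ZB` of the block algebra `B`. -/
abbrev IsBlockIdempotent.Center {F G : Type*} [Field F] [Group G] {e : MonoidAlgebra F G}
    (he : IsBlockIdempotent e) : Type _ :=
  Subring.center he.BlockAlgebra

section ModularSystem

variable (O K : Type*) {G : Type*} [CommRing O] [IsLocalRing O] [Field K] [Algebra O K] [Group G]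

/-- A representation `ρ` of `G` over `K` belongs to the block `B` of `FG` (`F` the residue field
of `O`) with block idempotent `e` if the central idempotent of `OG` that lifts `e` acts on it
as the identity. -/
def OrdinaryBelongsTo (e : MonoidAlgebra (ResidueField O) G) {V : Type*} [AddCommGroup V]
    [Module K V] (ρ : Representation K G V) : Prop :=
  ∃ e' : MonoidAlgebra O G, e' ∈ Subring.center (MonoidAlgebra O G) ∧ IsIdempotentElem e' ∧
    MonoidAlgebra.mapRingHom G (residue O) e' = e ∧
    ρ.asAlgebraHom (MonoidAlgebra.mapRingHom G (algebraMap O K) e') = 1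

/-- `Irr(B)`: the irreducible ordinary characters associated to the block with idempotent `e`. -/
def irr (e : MonoidAlgebra (ResidueField O) G) : Set (G → K) :=
  {χ | ∃ (n : ℕ) (ρ : Representation K G (Fin n → K)), ρ.IsIrreducible ∧
    OrdinaryBelongsTo O K e ρ ∧ χ = ρ.character}

/-- `k(B)`: the number of irreducible ordinary characters associated to `B`. -/
def numOrdinary (e : MonoidAlgebra (ResidueField O) G) : ℕ := (irr O K e).ncard

variable {O} in
/-- A monic polynomial `P` over `O` is the root-of-unity lift (for exponent `m`) of the polynomial
`f` over the residue field if it reduces to `f` and all its roots are `m`-th roots of unity.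
If `f` is the characteristic polynomial of an element of order `m` prime to the residue
characteristic, and `O` is complete, then there is exactly one such `P` (existence by Hensel's
lemma applied to `X ^ m - 1`; for uniqueness see `IsUnityLift.unique`), and its roots
are the lifts to characteristic `0` of the eigenvalues, i.e. of the roots of `f`. -/
structure IsUnityLift (m : ℕ) (f : (ResidueField O)[X]) (P : O[X]) : Prop where
  monic : P.Monic
  map_residue : P.map (residue O) = f
  pow_eq_one : ∀ ξ ∈ P.aroots (AlgebraicClosure K), ξ ^ m = 1

/-- The `p`-regular elements of `G`. -/
abbrev PRegular (p : ℕ) (G : Type*) [Group G] : Type _ := {g : G // (orderOf g).Coprime p}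

/-- `θ` is the Brauer character afforded by the representation `ρ` over the residue field `F` of
`O`: for each `p`-regular `g`, the value `θ g` is the sum (with multiplicity) of the lifts to
roots of unity in characteristic `0` of the eigenvalues of `ρ g`. No roots of unity are required
to lie in `F` or `K`: the lifts are taken in an algebraic closure of `K`. -/
def IsBrauerCharacter (p : ℕ) {V : Type*} [AddCommGroup V] [Module (ResidueField O) V]
    [Module.Finite (ResidueField O) V] (ρ : Representation (ResidueField O) G V)
    (θ : PRegular p G → AlgebraicClosure K) : Prop :=
  ∀ g : PRegular p G, ∃ P : O[X], IsUnityLift K (orderOf g.1) (ρ g.1).charpoly P ∧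
    θ g = (P.aroots (AlgebraicClosure K)).sum

/-- `IBr(B)`: the irreducible Brauer characters associated to the block `B` with idempotent `e`,
i.e. those afforded by the irreducible representations over `F` on which `e` acts as the
identity. -/
def ibr (p : ℕ) (e : MonoidAlgebra (ResidueField O) G) :
    Set (PRegular p G → AlgebraicClosure K) :=
  {θ | ∃ (n : ℕ) (ρ : Representation (ResidueField O) G (Fin n → ResidueField O)),
    ρ.IsIrreducible ∧ ρ.asAlgebraHom e = 1 ∧ IsBrauerCharacter O K p ρ θ}

/-- `l(B)`: the number of irreducible Brauer characters associated to `B`. -/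
def numBrauer (p : ℕ) (e : MonoidAlgebra (ResidueField O) G) : ℕ := (ibr O K p e).ncard

end ModularSystem

/-- The root-of-unity lift is unique; hence a representation affords at most one Brauer
character. -/
theorem IsUnityLift.unique {O K : Type*} [CommRing O] [IsDomain O] [IsLocalRing O] [Field K]
    [Algebra O K] [IsFractionRing O K] {m : ℕ} (hm : (m : ResidueField O) ≠ 0)
    {f : (ResidueField O)[X]} {P Q : O[X]} (hP : IsUnityLift K m f P) (hQ : IsUnityLift K m f Q) :
    P = Q := by
  have hm0 : m ≠ 0 := by rintro rfl; simp at hm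
  set L := AlgebraicClosure K
  let R := integralClosure O L
  have hinjL : Function.Injective (algebraMap O L) := by
    rw [IsScalarTower.algebraMap_eq O K L]
    exact (algebraMap K L).injective.comp (IsFractionRing.injective O K)
  have hinjR : Function.Injective (algebraMap O R) := by
    intro a b h
    apply hinjL
    rw [IsScalarTower.algebraMap_apply O R L, IsScalarTower.algebraMap_apply O R L b, h]
  have hint : (algebraMap O R).IsIntegral := algebraMap_isIntegral_iff.mpr inferInstance
  obtain ⟨M, hM, hMc⟩ := Ideal.exists_ideal_over_maximal_of_isIntegral (S := R)
    (maximalIdeal O) (by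
      rw [(RingHom.injective_iff_ker_eq_bot _).mp hinjR]; exact bot_le)
  let φ : R →+* R ⧸ M := Ideal.Quotient.mk M
  have : Field (R ⧸ M) := Ideal.Quotient.field M
  have key : ∀ a : O, residue O a = 0 ↔ φ (algebraMap O R a) = 0 := by
    intro a
    rw [residue_eq_zero_iff, ← hMc, Ideal.mem_comap, Ideal.Quotient.eq_zero_iff_mem]
  have hmM : (m : R ⧸ M) ≠ 0 := by
    intro h
    apply hm
    have := (key (m : O)).mpr (by simpa using h)
    simpa using this
  have hinj : ∀ x y : R, x ^ m = 1 → y ^ m = 1 → φ x = φ y → x = y := by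
    intro x y hx hy hxy
    by_contra hne
    have hg := (Commute.all x y).mul_geom_sum₂ m
    rw [hx, hy, sub_self] at hg
    have h0 := (mul_eq_zero.mp hg).resolve_left (sub_ne_zero.mpr hne)
    have h1 := congrArg φ h0
    simp only [map_sum, map_mul, map_pow, map_zero, hxy] at h1
    have h2 : ∀ i ∈ Finset.range m, φ y ^ i * φ y ^ (m - 1 - i) = φ y ^ (m - 1) := by
      intro i hi
      rw [← pow_add]; congr 1
      have := Finset.mem_range.mp hi
      omega
    rw [Finset.sum_congr rfl h2] at h1
    simp only [Finset.sum_const, Finset.card_range, nsmul_eq_mul] at h1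
    have h3 := (mul_eq_zero.mp h1).resolve_left hmM
    have h4 : φ y = 0 := eq_zero_of_pow_eq_zero h3
    have h5 : φ y ^ m = 1 := by rw [← map_pow, hy, map_one]
    rw [h4, zero_pow hm0] at h5
    exact zero_ne_one h5
  have hfac : ∀ {P : O[X]}, IsUnityLift K m f P → ∃ s : Multiset {x : R // x ^ m = 1},
      P.map (algebraMap O R) = (s.map fun x ↦ X - C x.1).prod := by
    intro P hP
    have hR : ∀ ξ ∈ P.aroots L, ∃ x : {x : R // x ^ m = 1}, (x.1 : L) = ξ := by
      intro ξ hξ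
      have h1 := hP.pow_eq_one ξ hξ
      refine ⟨⟨⟨ξ, ?_⟩, ?_⟩, rfl⟩
      · exact IsIntegral.of_pow (Nat.pos_of_ne_zero hm0) (h1 ▸ isIntegral_one)
      · exact Subtype.ext h1
    have : Nonempty {x : R // x ^ m = 1} := ⟨⟨1, one_pow m⟩⟩
    choose! g hg using hR
    refine ⟨(P.aroots L).map g, ?_⟩
    apply Polynomial.map_injective (algebraMap R L) Subtype.val_injective
    rw [Polynomial.map_map, ← IsScalarTower.algebraMap_eq, Polynomial.map_multiset_prod]
    have hs := (IsAlgClosed.splits (P.map (algebraMap O L))).eq_prod_roots_of_monic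
      (hP.monic.map _)
    rw [hs, Multiset.map_map, Multiset.map_map]
    congr 1
    refine Multiset.map_congr rfl fun ξ hξ ↦ ?_
    have := hg ξ hξ
    simp only [Function.comp, Polynomial.map_sub, Polynomial.map_X, Polynomial.map_C]
    rw [show algebraMap R L (g ξ).1 = ξ from this]
  obtain ⟨s, hs⟩ := hfac hP
  obtain ⟨t, ht⟩ := hfac hQ
  have hred : (P.map (algebraMap O R)).map φ = (Q.map (algebraMap O R)).map φ := by
    ext i
    have h1 : residue O (P.coeff i - Q.coeff i) = 0 := by
      have := congrArg (fun q ↦ q.coeff i) (hP.map_residue.trans hQ.map_residue.symm)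
      simpa [sub_eq_zero] using this
    have h2 := (key _).mp h1
    simpa [sub_eq_zero] using h2
  have hst : s.map (fun x ↦ φ x.1) = t.map (fun x ↦ φ x.1) := by
    rw [hs, ht, Polynomial.map_multiset_prod, Polynomial.map_multiset_prod] at hred
    have := congrArg Polynomial.roots hred
    have e : ∀ u : Multiset {x : R // x ^ m = 1},
        (u.map fun x ↦ X - C x.1).map (Polynomial.map φ)
          = (u.map fun x ↦ φ x.1).map fun a ↦ X - C a := by
      intro u; simp [Multiset.map_map]
    rwa [e, e, Polynomial.roots_multiset_prod_X_sub_C,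
      Polynomial.roots_multiset_prod_X_sub_C] at this
  have hsteq : s = t :=
    Multiset.map_injective (fun x y h ↦ Subtype.ext (hinj _ _ x.2 y.2 h)) hst
  apply Polynomial.map_injective _ hinjR
  rw [hs, ht, hsteq]

end BlockTheory

end

/-! For an irreducible `F`-representation of `B` with trace function `φ`, put `s_φ = ∑ φ(g⁻¹) g`.
This element lies in `ZB`. The coefficient of `z * s_φ` at `h` is the trace of `h⁻¹z`, which
vanishes when `z` is central and nilpotent; so `J(ZB)` kills `s_φ`
(`mul_characterSum_of_isNilpotent`). By density these trace functions are linearly independent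
(`linearIndependent_character`), so the annihilator `R` of `J = J(ZB)` has dimension at least
`l(B)`. In `ZB/R`, of dimension `d ≤ dim ZB - l(B)`, the image of `J` is nilpotent, hence `J^d ⊆ R`
and `J^(d+1) = 0` (`loewyLength_add_finrank_le`).

It remains to see `dim ZB ≤ k(B)`. Completeness lifts `e` to a central idempotent over `O`; a basis
of `ZB` then lifts to central elements independent over `K` (`finrank_centerPart_le`). In
characteristic zero, central elements of the lifted block are determined by their traces on `Irr(B)`
(`finrank_centerPart_le_numOrdinary`). -/

noncomputable section

open Polynomial IsLocalRing

namespace BlockTheory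

/-! ### Density and linear independence of characters -/

section Density

/-- Density: if the `V i` are pairwise non-isomorphic simple modules with only scalar
endomorphisms, then some element of `A` induces a given endomorphism of `V j` and kills
the other `V i`. -/
theorem exists_smul_eq_of_pairwise_nonisomorphic {k A ι : Type*} [Field k] [Ring A] [Algebra k A]
    [Finite ι] (V : ι → Type*) [∀ i, AddCommGroup (V i)] [∀ i, Module k (V i)]
    [∀ i, Module A (V i)] [∀ i, IsScalarTower k A (V i)] [∀ i, Module.Finite k (V i)]
    [∀ i, IsSimpleModule A (V i)]
    (hend : ∀ i (f : Module.End A (V i)), ∃ c : k, ∀ v, f v = c • v)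
    (hne : ∀ i j, Nonempty (V i ≃ₗ[A] V j) → i = j)
    (j : ι) (φ : V j →ₗ[k] V j) :
    ∃ a : A, (∀ v : V j, a • v = φ v) ∧ ∀ i ≠ j, ∀ v : V i, a • v = 0 := by
  classical
  have := Fintype.ofFinite ι
  -- Projecting to `V j` and applying `φ` commutes with every `A`-endomorphism of the product: by
  -- Schur these have no off-diagonal entries, and the entry at `j` is a scalar.
  let D : Module.End (Module.End A (∀ i, V i)) (∀ i, V i) :=
    { toFun := fun m ↦ Pi.single j (φ (m j))
      map_add' := fun m m' ↦ by simp [Pi.single_add]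
      map_smul' := fun T m ↦ by
        have hcomp : ∀ i l (x : V l), i ≠ l → T (Pi.single l x) i = 0 := by
          intro i l x hil
          let f : V l →ₗ[A] V i := (LinearMap.proj i).comp (T.comp (LinearMap.single A V l))
          rcases LinearMap.bijective_or_eq_zero f with h | h
          · exact absurd (hne l i ⟨LinearEquiv.ofBijective f h⟩).symm hil
          · exact LinearMap.congr_fun h x
        obtain ⟨c, hc⟩ := hend j ((LinearMap.proj j).comp (T.comp (LinearMap.single A V j)))
        replace hc : ∀ x, T (Pi.single j x) j = c • x := hc
        have h1 : T m j = c • m j := by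
          conv_lhs => rw [← Finset.univ_sum_single m]
          rw [map_sum, Finset.sum_apply, Finset.sum_eq_single j, hc]
          · exact fun l _ hl ↦ hcomp j l _ hl.symm
          · simp
        simp only [RingHom.id_apply, Module.End.smul_def]
        rw [h1, map_smul]
        funext i
        by_cases hij : i = j
        · subst hij; rw [hc]; simp
        · rw [hcomp i j _ hij]; simp [hij] }
  let b := fun i ↦ Module.finBasis k (V i)
  -- Density only gives agreement on a finite set; bases of all factors suffice by `k`-linearity.
  obtain ⟨a, ha⟩ := jacobson_density D (Finset.univ.image
    fun x : Σ i, Fin (Module.finrank k (V i)) ↦ (Pi.single x.1 (b x.1 x.2) : ∀ i, V i))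
  have ha' : ∀ i t, (Pi.single j (φ ((Pi.single i (b i t) : ∀ i, V i) j)) : ∀ i, V i) =
      a • Pi.single i (b i t) := fun i t ↦ ha _ (Finset.mem_image.mpr ⟨⟨i, t⟩, by simp, rfl⟩)
  have hlin : ∀ i (ψ : V i →ₗ[k] V i), (∀ t, a • b i t = ψ (b i t)) → ∀ v, a • v = ψ v := by
    intro i ψ h v
    have : Algebra.lsmul k k (V i) a = ψ := (b i).ext h
    exact LinearMap.congr_fun this v
  refine ⟨a, hlin j φ fun t ↦ ?_, fun i hi ↦ hlin i 0 fun t ↦ ?_⟩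
  · simpa using (congrFun (ha' j t) j).symm
  · have := (congrFun (ha' i t) i).symm
    simpa [hi] using this

variable {k G : Type*} [Field k] [Group G]

theorem IsSplittingFieldFor.exists_eq_smul (hk : IsSplittingFieldFor k G) {n : ℕ}
    {ρ : Representation k G (Fin n → k)} (hρ : ρ.IsIrreducible)
    (f : Module.End (MonoidAlgebra k G) ρ.asModule) : ∃ c : k, ∀ v, f v = c • v := by
  let f' : Module.End k (Fin n → k) :=
    ρ.asModuleEquiv.toLinearMap ∘ₗ (f.restrictScalars k) ∘ₗ ρ.asModuleEquiv.symm.toLinearMap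
  obtain ⟨c, hc⟩ := hk n ρ hρ f' fun g ↦ by
    refine LinearMap.ext fun v ↦ ?_
    change f (ρ.asModuleEquiv.symm (ρ g v)) = _
    rw [ρ.asModuleEquiv_symm_map_rho, map_smul]
    change ρ.asAlgebraHom (MonoidAlgebra.of k G g) _ = _
    rw [ρ.asAlgebraHom_of]
    rfl
  exact ⟨c, fun v ↦ LinearMap.congr_fun hc v⟩

/-- The linear extension to the group algebra of the character of a representation. -/
def traceForm {V : Type*} [AddCommGroup V] [Module k V] (ρ : Representation k G V) :
    MonoidAlgebra k G →ₗ[k] k :=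
  LinearMap.trace k V ∘ₗ ρ.asAlgebraHom.toLinearMap

theorem traceForm_apply {V : Type*} [AddCommGroup V] [Module k V] (ρ : Representation k G V)
    (a : MonoidAlgebra k G) : traceForm ρ a = LinearMap.trace k V (ρ.asAlgebraHom a) := rfl

theorem traceForm_single {V : Type*} [AddCommGroup V] [Module k V] (ρ : Representation k G V)
    (g : G) (c : k) : traceForm ρ (MonoidAlgebra.single g c) = c * ρ.character g := by
  simp [traceForm_apply, Representation.character]

theorem traceForm_eq_sum [Fintype G] {V : Type*} [AddCommGroup V] [Module k V]
    (ρ : Representation k G V) (a : MonoidAlgebra k G) :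
    traceForm ρ a = ∑ g, a.coeff g * ρ.character g := by
  classical
  induction a using MonoidAlgebra.induction_linear with
  | zero => simp
  | add x y hx hy => simp [hx, hy, add_mul, Finset.sum_add_distrib]
  | single g c => simp [traceForm_single, Finsupp.single_apply]

/-- The characters of pairwise non-isomorphic irreducible representations over a splitting field
are linearly independent. -/
theorem linearIndependent_character (hk : IsSplittingFieldFor k G) {ι : Type*}
    {n : ι → ℕ} (ρ : ∀ i, Representation k G (Fin (n i) → k)) (hρ : ∀ i, (ρ i).IsIrreducible)
    (hne : ∀ i j, Nonempty ((ρ i).Equiv (ρ j)) → i = j) :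
    LinearIndependent k fun i ↦ (ρ i).character := by
  classical
  wlog hfin : Finite ι generalizing ι
  · refine linearIndependent_iff_finset_linearIndependent.mpr fun s ↦ ?_
    exact this (fun i : s ↦ ρ i) (fun i ↦ hρ i) (fun i j h ↦ Subtype.ext (hne i j h)) inferInstance
  have := Fintype.ofFinite ι
  rw [Fintype.linearIndependent_iff]
  intro c hc j
  have hT : ∑ i, c i • traceForm (ρ i) = 0 := by
    refine LinearMap.ext fun a ↦ ?_
    induction a using MonoidAlgebra.induction_linear with
    | zero => simp
    | add x y hx hy => rw [map_add, hx, hy]; simp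
    | single g r =>
      have := congrFun hc g
      simp only [Finset.sum_apply, Pi.smul_apply, smul_eq_mul, Pi.zero_apply] at this
      simp only [LinearMap.sum_apply, LinearMap.smul_apply, traceForm_single, smul_eq_mul,
        LinearMap.zero_apply, mul_left_comm _ r]
      rw [← Finset.mul_sum, this, mul_zero]
  have : ∀ i, IsSimpleModule (MonoidAlgebra k G) (ρ i).asModule := fun i ↦
    (Representation.irreducible_iff_isSimpleModule_asModule _).mp (hρ i)
  have hnt : Nontrivial (ρ j).asModule := IsSimpleModule.nontrivial (MonoidAlgebra k G) _
  have hn : 0 < n j := by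
    by_contra h0
    have h0 : n j = 0 := by omega
    have : IsEmpty (Fin (n j)) := by rw [h0]; infer_instance
    have : Subsingleton (Fin (n j) → k) := inferInstance
    exact not_subsingleton (ρ j).asModule this
  -- A rank-one projection has trace 1 in any characteristic, whereas the identity could have trace
  -- 0.
  let φ : (Fin (n j) → k) →ₗ[k] (Fin (n j) → k) :=
    (LinearMap.proj ⟨0, hn⟩).smulRight (Pi.single ⟨0, hn⟩ 1)
  have hφ : LinearMap.trace k _ φ = 1 := by
    simp [φ]
  obtain ⟨a, ha, ha'⟩ := exists_smul_eq_of_pairwise_nonisomorphic (k := k)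
    (A := MonoidAlgebra k G) (fun i ↦ (ρ i).asModule)
    (fun i ↦ hk.exists_eq_smul (hρ i))
    (fun i l ⟨f⟩ ↦ hne i l ⟨Representation.IntertwiningMap.ofBijective
      ((Representation.IntertwiningMap.equivLinearMapAsModule _ _).symm f.toLinearMap) f.bijective⟩) j φ
  have haj : (ρ j).asAlgebraHom a = φ := LinearMap.ext ha
  have hai : ∀ i ≠ j, (ρ i).asAlgebraHom a = 0 := fun i hi ↦ LinearMap.ext (ha' i hi)
  have := LinearMap.congr_fun hT a
  rw [LinearMap.sum_apply, Finset.sum_eq_single j] at this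
  · simpa [traceForm_apply, haj, hφ] using this
  · intro i _ hi
    simp [traceForm_apply, hai i hi]
  · simp

end Density

/-! ### Character sums annihilated by the radical -/

section CharacterSums

variable {G : Type*} [Group G]

/-- In this form centrality passes through coefficientwise operations: ring homomorphisms, choices
of preimages, adic limits. -/
theorem mem_center_iff_coeff_conj {R : Type*} [CommRing R] {x : MonoidAlgebra R G} :
    x ∈ Subring.center (MonoidAlgebra R G) ↔ ∀ g h : G, x.coeff (g * h * g⁻¹) = x.coeff h := by
  rw [Subring.mem_center_iff]
  constructor
  · intro hx g h
    have := congrArg (fun y ↦ y.coeff (g * h)) (hx (MonoidAlgebra.single g 1))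
    simpa using this.symm
  · intro hx y
    induction y using MonoidAlgebra.induction_linear with
    | zero => simp
    | add y z hy hz => rw [add_mul, mul_add, hy, hz]
    | single g r =>
      ext h
      have := hx g (g⁻¹ * h)
      simp only [mul_inv_cancel_left] at this
      simp [this, mul_comm]

variable {k : Type*} [Field k] [Finite G]

/-- The element `∑ χ(g⁻¹) g` of the group algebra, where `χ` is the character of `ρ`. -/
def characterSum {V : Type*} [AddCommGroup V] [Module k V] (ρ : Representation k G V) :
    MonoidAlgebra k G :=
  .ofCoeff (Finsupp.equivFunOnFinite.symm fun g ↦ ρ.character g⁻¹)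

variable {V : Type*} [AddCommGroup V] [Module k V] (ρ : Representation k G V)

theorem coeff_characterSum (g : G) : (characterSum ρ).coeff g = ρ.character g⁻¹ := rfl

/-- Both sides are linear in `z`, and for `z = g` both equal `χ(h⁻¹g)`. Products with the character
sum thus become traces. -/
theorem coeff_mul_characterSum (z : MonoidAlgebra k G) (h : G) :
    (z * characterSum ρ).coeff h = traceForm ρ (MonoidAlgebra.single h⁻¹ 1 * z) := by
  induction z using MonoidAlgebra.induction_linear with
  | zero => simp
  | add x y hx hy => simp [add_mul, mul_add, hx, hy]
  | single g c => simp [traceForm_single, coeff_characterSum, MonoidAlgebra.single_mul_single]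

theorem characterSum_mem_center : characterSum ρ ∈ Subring.center (MonoidAlgebra k G) := by
  rw [mem_center_iff_coeff_conj]
  intro g h
  simp only [coeff_characterSum, mul_inv_rev, inv_inv]
  rw [← mul_assoc, ρ.char_conj]

theorem mul_characterSum_of_asAlgebraHom_eq_one {e : MonoidAlgebra k G}
    (he : ρ.asAlgebraHom e = 1) : e * characterSum ρ = characterSum ρ := by
  ext h
  rw [coeff_mul_characterSum, traceForm_apply, map_mul, he, mul_one]
  simp [coeff_characterSum, Representation.character]

/-- As `z` commutes with `h⁻¹`, the product `h⁻¹z` is nilpotent and has trace zero. -/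
theorem mul_characterSum_of_isNilpotent [Module.Finite k V] {z : MonoidAlgebra k G}
    (hz : z ∈ Subring.center (MonoidAlgebra k G)) (hn : IsNilpotent z) :
    z * characterSum ρ = 0 := by
  ext h
  have h1 : IsNilpotent (MonoidAlgebra.single h⁻¹ 1 * z) :=
    Commute.isNilpotent_mul_left (Subring.mem_center_iff.mp hz _) hn
  have h2 := LinearMap.isNilpotent_trace_of_isNilpotent (h1.map ρ.asAlgebraHom)
  rw [coeff_mul_characterSum, traceForm_apply, h2.eq_zero]
  rfl

/-- If `N` is a nilpotent ideal of a commutative algebra of finite dimension `d`, then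
`N ^ d = 0`. -/
theorem pow_finrank_eq_bot_of_isNilpotent {A : Type*} [CommRing A] [Algebra k A]
    [Module.Finite k A] {N : Ideal A} (hN : IsNilpotent N) :
    N ^ Module.finrank k A = ⊥ := by
  by_contra hne
  -- Once two consecutive powers agree the chain is constant, hence zero; until then each step loses
  -- a dimension.
  have hsub : ∀ n, N ^ n ≠ ⊥ → N ^ (n + 1) < N ^ n := by
    intro n hn
    refine lt_of_le_of_ne (Ideal.pow_le_pow_right n.le_succ) fun h ↦ hn ?_
    obtain ⟨m, hm⟩ := hN
    have : ∀ j, N ^ (n + j) = N ^ n := by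
      intro j
      induction j with
      | zero => rfl
      | succ j ih => rw [← add_assoc, pow_succ, ih, ← pow_succ, h]
    rw [← this m, pow_add, hm]
    simp
  have hdim : ∀ n, n ≤ Module.finrank k A →
      Module.finrank k ((N ^ n).restrictScalars k) + n ≤ Module.finrank k A := by
    intro n
    induction n with
    | zero => intro _; exact (Submodule.finrank_le _)
    | succ n ih =>
      intro hn
      have h1 : N ^ n ≠ ⊥ := fun h ↦ hne <| by
        rw [eq_bot_iff, ← h]; exact Ideal.pow_le_pow_right (by omega)
      have h2 : (N ^ (n + 1)).restrictScalars k < (N ^ n).restrictScalars k := hsub n h1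
      have := Submodule.finrank_lt_finrank_of_lt h2
      have := ih (by omega)
      omega
  have h0 := hdim _ le_rfl
  have : (N ^ Module.finrank k A).restrictScalars k = ⊥ :=
    Submodule.finrank_eq_zero.mp (by omega)
  exact hne (by simpa using this)

/-- A bound for the Loewy length from a subspace annihilated by the radical. -/
theorem loewyLength_add_finrank_le {A : Type*} [CommRing A] [Algebra k A]
    [Module.Finite k A] (S : Submodule k A) (hS : ∀ x ∈ Ring.jacobson A, ∀ s ∈ S, x * s = 0) :
    loewyLength A + Module.finrank k S ≤ Module.finrank k A + 1 := by
  have : IsArtinianRing A := IsArtinianRing.of_finite k A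
  have hJ : IsNilpotent (Ring.jacobson A) := by
    rw [← Ideal.jacobson_bot]
    exact IsArtinianRing.isNilpotent_jacobson_bot
  let R : Ideal A := (Ring.jacobson A).annihilator
  have hSR : S ≤ R.restrictScalars k := fun s hs ↦ by
    refine Submodule.mem_annihilator.mpr fun x hx ↦ ?_
    rw [smul_eq_mul, mul_comm]; exact hS x hx s hs
  have h1 := Submodule.finrank_mono hSR
  have h2 := Submodule.finrank_quotient_add_finrank (R.restrictScalars k)
  have hq : IsNilpotent ((Ring.jacobson A).map (Ideal.Quotient.mk R)) := by
    obtain ⟨m, hm⟩ := hJ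
    refine ⟨m, ?_⟩
    rw [← Ideal.map_pow, hm]; exact Ideal.map_bot
  have h3 := pow_finrank_eq_bot_of_isNilpotent (k := k) hq
  rw [← Ideal.map_pow, Ideal.map_eq_bot_iff_le_ker, Ideal.mk_ker] at h3
  -- The extra factor accounts for the `+ 1`: it kills what lies in the annihilator `R`.
  have h4 : Ring.jacobson A ^ (Module.finrank k (A ⧸ R) + 1) = ⊥ := by
    rw [pow_succ, eq_bot_iff]
    refine (Ideal.mul_mono_left h3).trans ?_
    rw [Submodule.annihilator_mul]
  have h5 : loewyLength A ≤ Module.finrank k (A ⧸ R) + 1 := Nat.sInf_le h4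
  have h6 : Module.finrank k (A ⧸ R) = Module.finrank k (A ⧸ R.restrictScalars k) := rfl
  omega

end CharacterSums

/-! ### Lifting from the residue field -/

section Lifting

variable {G : Type*} [Group G] {O : Type*} [CommRing O]

/-- Any set-theoretic section of `f`, applied to the coefficients, keeps them constant on conjugacy
classes. -/
theorem exists_center_mapRingHom_eq [Finite G] {R : Type*} [CommRing R] {f : O →+* R}
    (hf : Function.Surjective f) {z : MonoidAlgebra R G}
    (hz : z ∈ Subring.center (MonoidAlgebra R G)) :
    ∃ z' ∈ Subring.center (MonoidAlgebra O G), MonoidAlgebra.mapRingHom G f z' = z := by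
  obtain ⟨s, hs⟩ := hf.hasRightInverse
  refine ⟨.ofCoeff (Finsupp.equivFunOnFinite.symm fun g ↦ s (z.coeff g)), ?_, ?_⟩
  · rw [mem_center_iff_coeff_conj] at hz ⊢
    intro g h
    exact congrArg s (hz g h)
  · ext g
    rw [MonoidAlgebra.coeff_mapRingHom]
    exact hs _

theorem exists_eq_pow_smul [Finite G] {I : Ideal O} {π : O} (hI : I = Ideal.span {π}) {n : ℕ}
    {x : MonoidAlgebra O G} (hx : ∀ g, x.coeff g ∈ I ^ n) :
    ∃ y : MonoidAlgebra O G, x = π ^ n • y := by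
  have h : ∀ g, ∃ c, x.coeff g = π ^ n * c := fun g ↦ by
    have := hx g
    rwa [hI, Ideal.span_singleton_pow, Ideal.mem_span_singleton] at this
  choose c hc using h
  refine ⟨.ofCoeff (Finsupp.equivFunOnFinite.symm c), ?_⟩
  ext g
  exact hc g

theorem coeff_mem_pow_of_eq_smul {I : Ideal O} {π : O} (hI : I = Ideal.span {π}) {n : ℕ}
    {x y : MonoidAlgebra O G} (hx : x = π ^ n • y) (g : G) : x.coeff g ∈ I ^ n := by
  rw [hx, hI, Ideal.span_singleton_pow, Ideal.mem_span_singleton]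
  exact ⟨y.coeff g, rfl⟩

/-- Central idempotents of the group algebra lift along the reduction modulo a principal ideal
with respect to which the base ring is complete. -/
theorem exists_idempotent_lift [Finite G] {R : Type*} [CommRing R] {f : O →+* R}
    (hf : Function.Surjective f) {π : O} {I : Ideal O} (hI : I = Ideal.span {π})
    (hker : RingHom.ker f = I) [IsAdicComplete I O]
    {e : MonoidAlgebra R G} (he : e ∈ Subring.center (MonoidAlgebra R G))
    (hid : IsIdempotentElem e) :
    ∃ e' ∈ Subring.center (MonoidAlgebra O G), IsIdempotentElem e' ∧
      MonoidAlgebra.mapRingHom G f e' = e := by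
  have hhaus : ∀ a : O, (∀ n, a ∈ I ^ n) → a = 0 := fun a ha ↦
    IsHausdorff.haus' (I := I) a fun n ↦ by
      rw [SModEq.zero]; simpa using ha n
  obtain ⟨z, hz, hze⟩ := exists_center_mapRingHom_eq hf he
  -- Newton's step for `X² - X`, with `2x - 1` in place of its inverse since `(2x - 1)² = 1 + 4(x² -
  -- x)`. The defect `w = x² - x` becomes `w²(4w - 3)`.
  let N : MonoidAlgebra O G → MonoidAlgebra O G := fun x ↦ x - (2 * x - 1) * (x * x - x)
  let x : ℕ → MonoidAlgebra O G := fun n ↦ N^[n] z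
  have hx0 : x 0 = z := rfl
  have hxs : ∀ n, x (n + 1) = x n - (2 * x n - 1) * (x n * x n - x n) := fun n ↦
    Function.iterate_succ_apply' N n z
  have hxc : ∀ n, x n ∈ Subring.center (MonoidAlgebra O G) := by
    intro n
    induction n with
    | zero => exact hz
    | succ n ih =>
      rw [hxs]
      exact sub_mem ih (mul_mem (sub_mem (mul_mem (ofNat_mem _ 2) ih) (one_mem _))
        (sub_mem (mul_mem ih ih) ih))
  have hxe : ∀ n, MonoidAlgebra.mapRingHom G f (x n) = e := by
    intro n
    induction n with
    | zero => exact hze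
    | succ n ih => rw [hxs]; simp [ih, hid.eq]
  have hw : ∀ n, ∃ y, x n * x n - x n = π ^ (n + 1) • y := by
    intro n
    induction n with
    | zero =>
      refine exists_eq_pow_smul hI fun g ↦ ?_
      rw [zero_add, pow_one, ← hker, RingHom.mem_ker, ← MonoidAlgebra.coeff_mapRingHom, map_sub,
        map_mul, hxe, hid.eq, sub_self]
      rfl
    | succ n ih =>
      obtain ⟨y, hy⟩ := ih
      have h1 : x (n + 1) * x (n + 1) - x (n + 1) =
          (x n * x n - x n) * (x n * x n - x n) * (4 * (x n * x n - x n) - 3) := by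
        rw [hxs]; noncomm_ring
      rw [h1, hy]
      refine ⟨π ^ n • (y * y * (4 * (π ^ (n + 1) • y) - 3)), ?_⟩
      rw [smul_mul_smul_comm, smul_mul_assoc, smul_smul]
      congr 1
      ring
  have hcons : ∀ g n, (x (n + 1)).coeff g - (x n).coeff g ∈ I ^ n := by
    intro g n
    obtain ⟨y, hy⟩ := hw n
    have h1 : x (n + 1) - x n = π ^ n • (π • (-(2 * x n - 1) * y)) := by
      rw [hxs, hy, smul_smul, ← pow_succ, sub_sub_cancel_left, mul_smul_comm, neg_mul, smul_neg]
    exact coeff_mem_pow_of_eq_smul hI h1 g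
  have hcauchy : ∀ g n j, (x (n + j)).coeff g - (x n).coeff g ∈ I ^ n := by
    intro g n j
    induction j with
    | zero => simp
    | succ j ih =>
      have := Ideal.pow_le_pow_right (Nat.le_add_right n j) (hcons g (n + j))
      simpa [add_assoc] using add_mem this ih
  have hlim : ∀ g, ∃ L : O, ∀ n, L - (x n).coeff g ∈ I ^ n := by
    intro g
    obtain ⟨L, hL⟩ := IsPrecomplete.prec' (I := I) (fun n ↦ (x n).coeff g) fun {m n} hmn ↦ by
      obtain ⟨j, rfl⟩ := Nat.exists_eq_add_of_le hmn
      rw [SModEq.comm, SModEq.sub_mem]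
      simpa using hcauchy g m j
    refine ⟨L, fun n ↦ ?_⟩
    have := (hL n).symm
    rw [SModEq.sub_mem] at this
    simpa using this
  choose L hL using hlim
  let e' : MonoidAlgebra O G := .ofCoeff (Finsupp.equivFunOnFinite.symm L)
  have hd : ∀ n, ∃ d, e' - x n = π ^ n • d := fun n ↦ exists_eq_pow_smul hI fun g ↦ hL g n
  refine ⟨e', ?_, ?_, ?_⟩
  · rw [mem_center_iff_coeff_conj]
    intro g h
    refine sub_eq_zero.mp (hhaus _ fun n ↦ ?_)
    have h1 := sub_mem (hL (g * h * g⁻¹) n) (hL h n)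
    rw [mem_center_iff_coeff_conj.mp (hxc n), sub_sub_sub_cancel_right] at h1
    exact h1
  · refine sub_eq_zero.mp ?_
    ext g
    refine hhaus _ fun n ↦ ?_
    obtain ⟨d, hd⟩ := hd n
    obtain ⟨y, hy⟩ := hw n
    -- The defect of `e'` is that of `x n` plus terms containing `e' - x n`, all divisible by `π ^
    -- n`.
    refine coeff_mem_pow_of_eq_smul hI (y := π • y + d * e' + x n * d - d) ?_ g
    have h1 : e' * e' - e' = (x n * x n - x n) + (e' - x n) * e' + x n * (e' - x n)
        - (e' - x n) := by noncomm_ring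
    rw [h1, hd, hy, smul_sub, smul_add, smul_add, smul_smul, ← pow_succ, smul_mul_assoc,
      mul_smul_comm]
  · ext g
    have h1 := hL g 1
    rw [pow_one, ← hker, RingHom.mem_ker, map_sub, ← MonoidAlgebra.coeff_mapRingHom, hxe,
      sub_eq_zero] at h1
    rw [MonoidAlgebra.coeff_mapRingHom]
    exact h1

/-- A family of elements of the group algebra over `O` that is linearly independent over the
residue field is linearly independent over the fraction field. -/
theorem linearIndependent_mapRingHom [IsDomain O] [IsDiscreteValuationRing O] {K : Type*} [Field K]
    [Algebra O K] [IsFractionRing O K] {ι : Type*} [Finite ι] {v : ι → MonoidAlgebra O G}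
    (hv : LinearIndependent (ResidueField O)
      fun i ↦ MonoidAlgebra.mapRingHom G (residue O) (v i)) :
    LinearIndependent K fun i ↦ MonoidAlgebra.mapRingHom G (algebraMap O K) (v i) := by
  have := Fintype.ofFinite ι
  obtain ⟨π, hπ⟩ := IsDiscreteValuationRing.exists_irreducible O
  have hm := hπ.maximalIdeal_eq
  rw [Fintype.linearIndependent_iff] at hv
  rw [← LinearIndependent.iff_fractionRing O K, Fintype.linearIndependent_iff]
  intro a ha
  have ha' : ∑ i, a i • v i = 0 := by
    ext g
    have := congrArg (fun y ↦ y.coeff g) ha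
    apply IsFractionRing.injective O K
    simp only [MonoidAlgebra.coeff_sum, MonoidAlgebra.coeff_smul, Finsupp.coe_finsetSum,
      Finset.sum_apply, Finsupp.smul_apply, MonoidAlgebra.coeff_mapRingHom] at this ⊢
    simpa [Algebra.smul_def] using this
  -- Descent: independence of the reductions makes `π` divide all coefficients of a relation, and
  -- `π` can be cancelled.
  have key : ∀ n, ∃ b : ι → O, (∀ i, a i = π ^ n * b i) ∧ ∑ i, b i • v i = 0 := by
    intro n
    induction n with
    | zero => exact ⟨a, by simp, ha'⟩
    | succ n ih =>
      obtain ⟨b, hb, hb'⟩ := ih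
      have h1 : ∀ i, residue O (b i) = 0 := hv _ <| by
        have := congrArg (MonoidAlgebra.mapRingHom G (residue O)) hb'
        rw [map_sum, map_zero] at this
        rw [← this]
        refine Finset.sum_congr rfl fun i _ ↦ ?_
        ext g
        simp
      have h2 : ∀ i, ∃ c, b i = π * c := fun i ↦ by
        have := (residue_eq_zero_iff _).mp (h1 i)
        rwa [hm, Ideal.mem_span_singleton] at this
      choose c hc using h2
      refine ⟨c, fun i ↦ by rw [hb, hc, pow_succ, mul_assoc], ?_⟩
      ext g
      have := congrArg (fun y ↦ y.coeff g) hb'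
      simp only [MonoidAlgebra.coeff_sum, MonoidAlgebra.coeff_smul, Finsupp.coe_finsetSum,
        Finset.sum_apply, Finsupp.smul_apply, hc, smul_eq_mul, mul_assoc, ← Finset.mul_sum] at this ⊢
      simpa [hπ.ne_zero] using this
  intro i
  by_contra hne
  have hfin : FiniteMultiplicity π (a i) := FiniteMultiplicity.of_not_isUnit hπ.not_isUnit hne
  obtain ⟨n, hn⟩ := hfin
  obtain ⟨b, hb, -⟩ := key (n + 1)
  exact hn ⟨b i, hb i⟩

end Lifting

/-! ### Dimension of the block center and ordinary characters -/

section Counting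

variable {k G : Type*} [Field k] [Group G]

/-- The representation on `Fin n → k` afforded by a module over the group algebra with a
`k`-basis indexed by `Fin n`. -/
def basisRepresentation {n : ℕ} {S : Type*} [AddCommGroup S] [Module k S]
    [Module (MonoidAlgebra k G) S] [IsScalarTower k (MonoidAlgebra k G) S]
    (φ : S ≃ₗ[k] (Fin n → k)) : Representation k G (Fin n → k) :=
  (MonoidAlgebra.lift k _ G).symm
    ((φ.conjAlgEquiv k).toAlgHom.comp (Algebra.lsmul k k S : MonoidAlgebra k G →ₐ[k] _))

theorem basisRepresentation_asAlgebraHom {n : ℕ} {S : Type*} [AddCommGroup S] [Module k S]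
    [Module (MonoidAlgebra k G) S] [IsScalarTower k (MonoidAlgebra k G) S]
    (φ : S ≃ₗ[k] (Fin n → k)) (a : MonoidAlgebra k G) (x : S) :
    (basisRepresentation φ).asAlgebraHom a (φ x) = φ (a • x) := by
  rw [Representation.asAlgebraHom_def, basisRepresentation, Equiv.apply_symm_apply]
  simp

theorem basisRepresentation_isIrreducible {n : ℕ} {S : Type*} [AddCommGroup S] [Module k S]
    [Module (MonoidAlgebra k G) S] [IsScalarTower k (MonoidAlgebra k G) S]
    [IsSimpleModule (MonoidAlgebra k G) S] (φ : S ≃ₗ[k] (Fin n → k)) :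
    (basisRepresentation (G := G) φ).IsIrreducible := by
  rw [Representation.irreducible_iff_isSimpleModule_asModule]
  let ψ : S ≃ₗ[MonoidAlgebra k G] (basisRepresentation (G := G) φ).asModule :=
    { toFun := φ
      invFun := φ.symm
      left_inv := φ.left_inv
      right_inv := φ.right_inv
      map_add' := φ.map_add
      map_smul' := fun a x ↦ (basisRepresentation_asAlgebraHom φ a x).symm }
  exact IsSimpleModule.congr ψ.symm

/-- In characteristic zero, an element of the group algebra that acts as zero in all irreducible
representations is zero. -/
theorem eq_zero_of_forall_isIrreducible [Finite G] [CharZero k] {z : MonoidAlgebra k G}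
    (hz : ∀ (n : ℕ) (ρ : Representation k G (Fin n → k)), ρ.IsIrreducible →
      ρ.asAlgebraHom z = 0) : z = 0 := by
  have : NeZero (Nat.card G : k) := ⟨Nat.cast_ne_zero.mpr Nat.card_pos.ne'⟩
  have hs : IsSemisimpleModule (MonoidAlgebra k G) (MonoidAlgebra k G) := inferInstance
  -- By Maschke the regular module is a sum of simple left ideals, and `z` kills each of them.
  have h1 : ∀ x ∈ (⊤ : Submodule (MonoidAlgebra k G) (MonoidAlgebra k G)), z * x = 0 := by
    rw [← IsSemisimpleModule.sSup_simples_eq_top, sSup_eq_iSup']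
    intro x hx
    induction hx using Submodule.iSup_induction' with
    | zero => simp
    | add x y _ _ hx hy => rw [mul_add, hx, hy, add_zero]
    | mem S x hx =>
      have : IsSimpleModule (MonoidAlgebra k G) S.1 := S.2
      have : Module.Finite k S.1 :=
        inferInstanceAs (Module.Finite k (S.1.restrictScalars k))
      let φ := (Module.finBasis k S.1).equivFun
      have h2 := basisRepresentation_asAlgebraHom (G := G) φ z ⟨x, hx⟩
      rw [hz _ _ (basisRepresentation_isIrreducible φ), LinearMap.zero_apply, eq_comm,
        LinearEquiv.map_eq_zero_iff] at h2
      exact congrArg Subtype.val h2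
  simpa using h1 1 trivial

theorem IsSplittingFieldFor.exists_asAlgebraHom_eq (hk : IsSplittingFieldFor k G) {n : ℕ}
    {ρ : Representation k G (Fin n → k)} (hρ : ρ.IsIrreducible) {z : MonoidAlgebra k G}
    (hz : z ∈ Subring.center (MonoidAlgebra k G)) : ∃ c : k, ρ.asAlgebraHom z = c • 1 := by
  refine hk n ρ hρ _ fun g ↦ ?_
  rw [← ρ.asAlgebraHom_of]
  exact Commute.map (Subring.mem_center_iff.mp hz _).symm ρ.asAlgebraHom

/-- The center of the block algebra, as a subspace of the group algebra. -/
def centerPart (e : MonoidAlgebra k G) : Submodule k (MonoidAlgebra k G) where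
  carrier := {z | z ∈ Subring.center (MonoidAlgebra k G) ∧ z * e = z}
  add_mem' := fun ha hb ↦ ⟨add_mem ha.1 hb.1, by rw [add_mul, ha.2, hb.2]⟩
  zero_mem' := ⟨zero_mem _, zero_mul e⟩
  smul_mem' := fun c x hx ↦ by
    refine ⟨Subring.mem_center_iff.mpr fun y ↦ ?_, by rw [smul_mul_assoc, hx.2]⟩
    rw [smul_mul_assoc, mul_smul_comm, Subring.mem_center_iff.mp hx.1]

section

variable {O K : Type*} [CommRing O] [Field K] [Algebra O K] [Finite G]

/-- Distinct characters are independent functions on a finite group. Finiteness keeps `ncard` in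
`numOrdinary` from taking its default value 0. -/
theorem finite_irr [IsLocalRing O] (hK : IsSplittingFieldFor K G) (e : MonoidAlgebra (ResidueField O) G) :
    (irr O K e).Finite := by
  choose n ρ hρ _ hχ using fun χ : irr O K e ↦ χ.2
  have h1 := linearIndependent_character hK ρ hρ fun χ ψ ⟨f⟩ ↦ Subtype.ext <| by
    rw [hχ χ, hχ ψ, Representation.char_iso f]
  have := h1.finite_of_isNoetherian
  exact Set.toFinite _

theorem finrank_centerPart_le_numOrdinary [IsLocalRing O] [CharZero K] (hK : IsSplittingFieldFor K G)
    {e : MonoidAlgebra (ResidueField O) G} {e' : MonoidAlgebra O G}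
    (hc : e' ∈ Subring.center (MonoidAlgebra O G)) (hid : IsIdempotentElem e')
    (hee : MonoidAlgebra.mapRingHom G (residue O) e' = e) :
    Module.finrank K (centerPart (MonoidAlgebra.mapRingHom G (algebraMap O K) e')) ≤
      numOrdinary O K e := by
  have := Fintype.ofFinite G
  have hfin := (finite_irr hK e).fintype
  set ε := MonoidAlgebra.mapRingHom G (algebraMap O K) e' with hε
  have hεc : ε ∈ Subring.center (MonoidAlgebra K G) := by
    rw [mem_center_iff_coeff_conj] at hc ⊢
    intro g h
    simp [hε, hc]
  have hεi : IsIdempotentElem ε := hid.map _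
  let Φ : MonoidAlgebra K G →ₗ[K] (irr O K e → K) :=
    { toFun := fun z χ ↦ ∑ g, z.coeff g * χ.1 g
      map_add' := fun x y ↦ by
        funext χ; simp [add_mul, Finset.sum_add_distrib]
      map_smul' := fun c x ↦ by
        funext χ; simp [Finset.mul_sum, mul_assoc] }
  have hΦ : ∀ (χ : irr O K e) (n : ℕ) (ρ : Representation K G (Fin n → K)), χ.1 = ρ.character →
      ∀ z, Φ z χ = traceForm ρ z := fun χ n ρ h z ↦ by
    rw [traceForm_eq_sum, ← h]; rfl
  have hinj : Function.Injective (Φ ∘ₗ (centerPart ε).subtype) := by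
    rw [← LinearMap.ker_eq_bot, LinearMap.ker_eq_bot']
    rintro ⟨z, hz, hze⟩ h0
    refine Subtype.ext (eq_zero_of_forall_isIrreducible fun n ρ hρ ↦ ?_)
    obtain ⟨c, hc'⟩ := hK.exists_asAlgebraHom_eq hρ hεc
    obtain ⟨d, hd⟩ := hK.exists_asAlgebraHom_eq hρ hz
    have hcd : ρ.asAlgebraHom z = d • c • 1 := by
      conv_lhs => rw [← hze, map_mul, hd, hc', smul_mul_assoc, one_mul]
    -- The idempotent `ε` acts as a scalar: either it kills `ρ`, and then so does `z = z * ε`, or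
    -- `ρ` belongs to the block.
    rcases eq_or_ne c 0 with rfl | hc0
    · simpa using hcd
    have h1 : ρ.asAlgebraHom ε = 1 := by
      have h2 : ρ.asAlgebraHom ε * ρ.asAlgebraHom ε = ρ.asAlgebraHom ε := by
        rw [← map_mul, hεi.eq]
      conv_lhs at h2 => rw [hc', smul_mul_assoc, one_mul]
      exact hc'.trans (smul_right_injective _ hc0 (h2.trans hc'))
    have hmem : ρ.character ∈ irr O K e := ⟨n, ρ, hρ, ⟨e', hc, hid, hee, h1⟩, rfl⟩
    have h2 : Φ z ⟨_, hmem⟩ = 0 := congrFun h0 ⟨_, hmem⟩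
    rw [hΦ _ n ρ rfl, traceForm_apply, hd, map_smul, LinearMap.trace_one, Module.finrank_fin_fun,
      smul_eq_mul, mul_eq_zero] at h2
    rw [hd]
    -- The trace is `d * n`, and characteristic zero excludes `n = 0` in `K` except for the zero
    -- space.
    rcases h2 with rfl | h2
    · simp
    · have : n = 0 := by exact_mod_cast h2
      subst this
      exact Subsingleton.elim _ _
  refine (LinearMap.finrank_le_finrank_of_injective hinj).trans ?_
  rw [Module.finrank_fintype_fun_eq_card, numOrdinary, Set.ncard_eq_toFinset_card',
    Set.toFinset_card]

/-- Central lifts of a basis, multiplied by `e'`, lie in the lifted block without changing their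
reductions. -/
theorem finrank_centerPart_le [IsDomain O] [IsDiscreteValuationRing O] [IsFractionRing O K]
    {e : MonoidAlgebra (ResidueField O) G} {e' : MonoidAlgebra O G}
    (hc : e' ∈ Subring.center (MonoidAlgebra O G)) (hid : IsIdempotentElem e')
    (hee : MonoidAlgebra.mapRingHom G (residue O) e' = e) :
    Module.finrank (ResidueField O) (centerPart e) ≤
      Module.finrank K (centerPart (MonoidAlgebra.mapRingHom G (algebraMap O K) e')) := by
  let b := Module.finBasis (ResidueField O) (centerPart e)
  choose z hz hzb using fun i ↦ exists_center_mapRingHom_eq (residue_surjective (R := O)) (b i).2.1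
  have h1 : ∀ i, MonoidAlgebra.mapRingHom G (residue O) (z i * e') = b i := fun i ↦ by
    rw [map_mul, hzb, hee, (b i).2.2]
  have h2 : LinearIndependent K
      fun i ↦ MonoidAlgebra.mapRingHom G (algebraMap O K) (z i * e') := by
    refine linearIndependent_mapRingHom ?_
    simp only [h1]
    exact b.linearIndependent.map' (centerPart e).subtype (Submodule.ker_subtype _)
  have h3 : ∀ i, MonoidAlgebra.mapRingHom G (algebraMap O K) (z i * e') ∈
      centerPart (MonoidAlgebra.mapRingHom G (algebraMap O K) e') := fun i ↦ by
    refine ⟨?_, by rw [← map_mul, mul_assoc, hid.eq]⟩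
    have := mem_center_iff_coeff_conj.mp (mul_mem (hz i) hc)
    rw [mem_center_iff_coeff_conj]
    intro g h
    rw [MonoidAlgebra.coeff_mapRingHom, this, MonoidAlgebra.coeff_mapRingHom]
  have h4 : LinearIndependent K fun i ↦
      (⟨_, h3 i⟩ : centerPart (MonoidAlgebra.mapRingHom G (algebraMap O K) e')) :=
    LinearIndependent.of_comp (Submodule.subtype _) h2
  simpa using h4.fintype_card_le_finrank

end

end Counting

/-! ### The center of the block algebra and its Loewy length -/

section Blocks

namespace IsBlockIdempotent

variable {F G : Type*} [Field F] [Group G] {e : MonoidAlgebra F G} (he : IsBlockIdempotent e)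

include he

theorem mem_corner_of_mem_centerPart {x : MonoidAlgebra F G} (hx : x ∈ centerPart e) :
    x ∈ Subsemigroup.corner e := by
  rw [Subsemigroup.mem_corner_iff he.idem]
  exact ⟨by rw [Subring.mem_center_iff.mp hx.1, hx.2], hx.2⟩

/-- Elements of the center of the block algebra, given by central elements of the group
algebra. -/
def toCenter (x : centerPart e) : he.Center :=
  ⟨⟨x, he.mem_corner_of_mem_centerPart x.2⟩, Subring.mem_center_iff.mpr fun y ↦
    Subtype.ext (Subring.mem_center_iff.mp x.2.1 y.1)⟩

/-- Since `e` is central, `x * y = x * (e * y * e)`, so commuting with the corner means commuting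
with the whole group algebra. -/
theorem coe_mem_centerPart (x : he.Center) : x.1.1 ∈ centerPart e := by
  have hx := (Subsemigroup.mem_corner_iff he.idem).mp x.1.2
  refine ⟨Subring.mem_center_iff.mpr fun y ↦ ?_, hx.2⟩
  have hc := Subring.mem_center_iff.mp he.mem_center
  have h1 : x.1.1 * (e * y * e) = e * y * e * x.1.1 :=
    congrArg Subtype.val (Subring.mem_center_iff.mp x.2 ⟨e * y * e, y, rfl⟩).symm
  have h2 : x.1.1 * (e * y * e) = x.1.1 * y := by
    rw [← mul_assoc, ← mul_assoc, hx.2, mul_assoc, hc, ← mul_assoc, hx.2]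
  have h3 : e * y * e * x.1.1 = y * x.1.1 := by
    rw [mul_assoc, hx.1, ← hc, mul_assoc, hx.1]
  rw [← h2, h1, h3]

/-- The center of the block algebra as an algebra over the base field. -/
abbrev centerAlgebra : Algebra F he.Center :=
  RingHom.toAlgebra
    { toFun := fun c ↦ he.toCenter
        ⟨c • e, (centerPart e).smul_mem c ⟨he.mem_center, he.idem.eq⟩⟩
      map_one' := Subtype.ext (Subtype.ext (one_smul F e))
      map_mul' := fun c d ↦ Subtype.ext <| Subtype.ext <| by
        change (c * d) • e = (c • e) * (d • e)
        rw [smul_mul_smul_comm, he.idem.eq]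
      map_zero' := Subtype.ext (Subtype.ext (zero_smul F e))
      map_add' := fun c d ↦ Subtype.ext (Subtype.ext (add_smul c d e)) }

/-- The center of the block algebra is linearly isomorphic to a subspace of the center of the
group algebra. -/
def centerEquiv : letI := he.centerAlgebra; he.Center ≃ₗ[F] centerPart e :=
  let := he.centerAlgebra
  { toFun := fun x ↦ ⟨x.1.1, he.coe_mem_centerPart x⟩
    invFun := he.toCenter
    left_inv := fun _ ↦ rfl
    right_inv := fun _ ↦ rfl
    map_add' := fun _ _ ↦ rfl
    map_smul' := fun c x ↦ Subtype.ext <| by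
      rw [Algebra.smul_def]
      change (c • e) * x.1.1 = c • x.1.1
      rw [smul_mul_assoc, ((Subsemigroup.mem_corner_iff he.idem).mp x.1.2).1] }

end IsBlockIdempotent

variable {G : Type*} [Group G]

/-- The Loewy length of the center of a block is bounded in terms of its dimension and of the
number of any family of pairwise non-isomorphic irreducible representations belonging to it. -/
theorem loewyLength_center_add_card_le [Finite G] {F : Type*} [Field F] (hF : IsSplittingFieldFor F G)
    {e : MonoidAlgebra F G} (he : IsBlockIdempotent e) {ι : Type*} [Fintype ι] {n : ι → ℕ}
    (ρ : ∀ i, Representation F G (Fin (n i) → F)) (hρ : ∀ i, (ρ i).IsIrreducible)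
    (hρe : ∀ i, (ρ i).asAlgebraHom e = 1) (hne : ∀ i j, Nonempty ((ρ i).Equiv (ρ j)) → i = j) :
    loewyLength he.Center + Fintype.card ι ≤ Module.finrank F (centerPart e) + 1 := by
  let := he.centerAlgebra
  have : Module.Finite F he.Center := Module.Finite.equiv he.centerEquiv.symm
  have : IsArtinianRing he.Center := IsArtinianRing.of_finite F _
  let a : ι → centerPart e := fun i ↦ ⟨characterSum (ρ i), characterSum_mem_center _, by
    rw [← Subring.mem_center_iff.mp (characterSum_mem_center (ρ i)),
      mul_characterSum_of_asAlgebraHom_eq_one _ (hρe i)]⟩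
  have ha : LinearIndependent F a := by
    have h1 := linearIndependent_character hF ρ hρ hne
    rw [Fintype.linearIndependent_iff] at h1 ⊢
    intro c hc
    refine h1 c (funext fun g ↦ ?_)
    have h2 := congrArg (fun x : centerPart e ↦ x.1.coeff g⁻¹) hc
    simpa [a, coeff_characterSum] using h2
  have hb : LinearIndependent F (he.centerEquiv.symm ∘ a) :=
    ha.map' he.centerEquiv.symm.toLinearMap (LinearEquiv.ker _)
  have h1 := loewyLength_add_finrank_le (k := F)
    (Submodule.span F (Set.range (he.centerEquiv.symm ∘ a))) fun x hx s hs ↦ by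
      have hxn : IsNilpotent x := by
        obtain ⟨m, hm⟩ := IsArtinianRing.isNilpotent_jacobson_bot (R := he.Center)
        rw [Ideal.jacobson_bot] at hm
        exact ⟨m, by simpa [hm] using Ideal.pow_mem_pow hx m⟩
      have hxn' : IsNilpotent x.1.1 := by
        obtain ⟨m, hm⟩ := hxn
        -- Only positive powers agree in the corner and in the group algebra, as their identities
        -- `e` and `1` may differ.
        refine ⟨m + 1, ?_⟩
        have hpow : ∀ m, (x ^ (m + 1)).1.1 = x.1.1 ^ (m + 1) := fun m ↦ by
          induction m with
          | zero => simp
          | succ m ih => rw [pow_succ, pow_succ _ (m + 1), ← ih]; rfl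
        rw [← hpow, pow_succ, hm, zero_mul]
        rfl
      induction hs using Submodule.span_induction with
      | zero => exact mul_zero x
      | add y z _ _ hy hz => rw [mul_add, hy, hz, add_zero]
      | smul c y _ hy => rw [mul_smul_comm, hy, smul_zero]
      | mem y hy =>
        obtain ⟨i, rfl⟩ := hy
        exact Subtype.ext <| Subtype.ext <|
          mul_characterSum_of_isNilpotent (ρ i) (he.coe_mem_centerPart x).1 hxn'
  rwa [finrank_span_eq_card hb, he.centerEquiv.finrank_eq] at h1

/-- Equivalent representations share characteristic polynomials, whose root-of-unity lifts are
unique because the order of a `p`-regular element is nonzero in the residue field. So distinct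
Brauer characters come from non-isomorphic representations, the only direction needed to bound
`l(B)`. -/
theorem IsBrauerCharacter.eq_of_equiv {p : ℕ} (hp : p.Prime) {O K : Type*} [CommRing O]
    [IsDomain O] [IsLocalRing O] [Field K] [Algebra O K] [IsFractionRing O K]
    [CharP (ResidueField O) p] {V W : Type*} [AddCommGroup V] [Module (ResidueField O) V]
    [Module.Finite (ResidueField O) V] [AddCommGroup W] [Module (ResidueField O) W]
    [Module.Finite (ResidueField O) W] {ρ : Representation (ResidueField O) G V}
    {σ : Representation (ResidueField O) G W} (f : ρ.Equiv σ)
    {θ η : PRegular p G → AlgebraicClosure K} (hθ : IsBrauerCharacter O K p ρ θ)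
    (hη : IsBrauerCharacter O K p σ η) : θ = η := by
  funext g
  obtain ⟨P, hP, hPθ⟩ := hθ g
  obtain ⟨Q, hQ, hQη⟩ := hη g
  have hm : (orderOf g.1 : ResidueField O) ≠ 0 := fun h ↦ by
    rw [CharP.cast_eq_zero_iff (ResidueField O) p] at h
    exact hp.one_lt.ne' (Nat.eq_one_of_dvd_coprimes g.2 h dvd_rfl)
  rw [← f.conj_apply_self g.1, LinearEquiv.charpoly_conj] at hQ
  rw [hPθ, hQη, hP.unique hm hQ]

end Blocks

end BlockTheory

end

theorem proposition2p2 {p : ℕ} (hp : p.Prime) {G : Type*} [Group G] [Finite G]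
    -- a splitting `p`-modular system `(K, O, F)` for `G`, with `F` the residue field of `O`
    {O K : Type*} [CommRing O] [IsDomain O] [IsDiscreteValuationRing O]
    [IsAdicComplete (IsLocalRing.maximalIdeal O) O]
    [Field K] [Algebra O K] [IsFractionRing O K] [CharZero K]
    [CharP (IsLocalRing.ResidueField O) p]
    (hK : BlockTheory.IsSplittingFieldFor K G)
    (hF : BlockTheory.IsSplittingFieldFor (IsLocalRing.ResidueField O) G)
    -- a block `B` of `FG`, given by its block idempotent
    {e : MonoidAlgebra (IsLocalRing.ResidueField O) G} (he : BlockTheory.IsBlockIdempotent e) :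
    (BlockTheory.loewyLength he.Center : ℤ) ≤
      (BlockTheory.numOrdinary O K e : ℤ) - (BlockTheory.numBrauer O K p e : ℤ) + 1 := by
  obtain ⟨π, hπ⟩ := IsDiscreteValuationRing.exists_irreducible O
  obtain ⟨e', hc, hid, hee⟩ := BlockTheory.exists_idempotent_lift
    (IsLocalRing.residue_surjective (R := O)) hπ.maximalIdeal_eq
    IsLocalRing.ker_residue he.mem_center he.idem
  have h1 := BlockTheory.finrank_centerPart_le (K := K) hc hid hee
  have h2 := BlockTheory.finrank_centerPart_le_numOrdinary hK hc hid hee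
  have h3 : BlockTheory.loewyLength he.Center + BlockTheory.numBrauer O K p e ≤
      Module.finrank (IsLocalRing.ResidueField O) (BlockTheory.centerPart e) + 1 := by
    choose n ρ hρ hρe hθ using fun θ : BlockTheory.ibr O K p e ↦ θ.2
    have hne : ∀ θ η, Nonempty ((ρ θ).Equiv (ρ η)) → θ = η := fun θ η ⟨f⟩ ↦
      Subtype.ext ((hθ θ).eq_of_equiv hp f (hθ η))
    have := (BlockTheory.linearIndependent_character hF ρ hρ hne).finite_of_isNoetherian
    have := Fintype.ofFinite (BlockTheory.ibr O K p e)
    have h4 := BlockTheory.loewyLength_center_add_card_le hF he ρ hρ hρe hne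
    rwa [← Nat.card_eq_fintype_card, Nat.card_coe_set_eq] at h4
  omega
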